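/- All graphs are finite and simple. The \emph{Euler genus} of a closed connected surface $\Sigma$ is $2-\chi(\Sigma)$, where $\chi(\Sigma)$ is its Euler characteristic; $\Sigma$ may be orientable or non-orientable. The \emph{Euler genus} of a graph $G$ is the minimum Euler genus of a closed connected surface in which $G$ embeds; here, $G$ embeds in $\Sigma$ means that some finite cell decomposition of $\Sigma$ has a subgraph of its $1$-skeleton isomorphic to $G$. A \emph{layering} of $G$ is a partition $(V_0,V_1,\dots,V_t)$ of $V(G)$ such that for every edge $vw$ of $G$, if $v\in V_i$ and $w\in V_j$ then $|i-j|\le 1$. A \emph{tree decomposition} of $G$ is a family $(B_x : x\in V(T))$ of subsets of $V(G)$ (called \emph{bags}) indexed by the vertices of a tree $T$ such that (1) for every edge $vw$ of $G$ some bag contains both $v$ and $w$, and (2) for every vertex $v$ of $G$ the set $\{x\in V(T): v\in B_x\}$ induces a non-empty connected subgraph of $T$. Its \emph{layered width} is the minimum integer $\ell$ such that, for some layering $(V_0,\dots,V_t)$ of $G$, $|B_x\cap V_i|\le \ell$ for all $x\in V(T)$ and all $i\in\{0,\dots,t\}$. The \emph{layered treewidth} of $G$ is the minimum layered width of a tree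 decomposition of $G$. \textbf{Theorem.} Every graph $G$ with Euler genus $g$ has layered treewidth at most $2g+3$. -/

import Mathlib

/-- A closed connected surface given by a finite cell decomposition, encoded by its flags.
`D` is the set of flags, that is, of triangles (vertex, edge, face) of the barycentric subdivision.
Each flag has exactly one neighbour across each of its three sides: `flipVertex` (respectively
`flipEdge`, `flipFace`) moves to the neighbouring flag which may have a different vertex
(respectively edge, face) and has the other two cells in common.  The faces are
open discs; loops, parallel edges and vertices of degree one are allowed in the 1-skeleton, and
the surface may be orientable or non-orientable. -/
structure CellularSurface (D : Type*) where
  flipVertex : D → D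
  flipEdge : D → D
  flipFace : D → D
  flipVertex_flipVertex : ∀ a, flipVertex (flipVertex a) = a
  flipEdge_flipEdge : ∀ a, flipEdge (flipEdge a) = a
  flipFace_flipFace : ∀ a, flipFace (flipFace a) = a
  flipVertex_ne : ∀ a, flipVertex a ≠ a
  flipEdge_ne : ∀ a, flipEdge a ≠ a
  flipFace_ne : ∀ a, flipFace a ≠ a
  /-- Every edge consists of exactly four flags (two ends and two sides). -/
  flipVertex_flipFace : ∀ a, flipVertex (flipFace a) = flipFace (flipVertex a)
  flipVertex_flipFace_ne : ∀ a, flipVertex (flipFace a) ≠ a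
  nonempty : Nonempty D
  connected : ∀ a b, Relation.EqvGen
    (fun x y => flipVertex x = y ∨ flipEdge x = y ∨ flipFace x = y) a b

namespace CellularSurface

variable {D : Type*} (M : CellularSurface D)

/-- The vertices: classes of flags under the moves that keep the vertex. -/
def Vertex : Type _ := Quot fun a b : D => M.flipEdge a = b ∨ M.flipFace a = b

/-- The edges: classes of flags under the moves that keep the edge. -/
def Edge : Type _ := Quot fun a b : D => M.flipVertex a = b ∨ M.flipFace a = b

/-- The faces: classes of flags under the moves that keep the face. -/
def Face : Type _ := Quot fun a b : D => M.flipVertex a = b ∨ M.flipEdge a = b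

/-- The vertex of a flag. -/
def vertexOf (a : D) : M.Vertex := Quot.mk _ a

/-- The Euler characteristic of the surface (used when the set of flags is finite). -/
noncomputable def eulerChar : ℤ :=
  (Nat.card M.Vertex : ℤ) - (Nat.card M.Edge : ℤ) + (Nat.card M.Face : ℤ)

/-- The Euler genus of the surface, `2 - χ`. -/
noncomputable def eulerGenus : ℤ := 2 - M.eulerChar

/-- The simple graph underlying the 1-skeleton: two distinct vertices are adjacent when they are
the two ends of some edge. -/
def skeleton : SimpleGraph M.Vertex where
  Adj x y := x ≠ y ∧ ∃ a : D, M.vertexOf a = x ∧ M.vertexOf (M.flipVertex a) = y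
  symm := ⟨by
    rintro x y ⟨hne, a, hx, hy⟩
    exact ⟨hne.symm, M.flipVertex a, hy, by rw [M.flipVertex_flipVertex]; exact hx⟩⟩
  loopless := ⟨fun _ h => h.1 rfl⟩

end CellularSurface

namespace SimpleGraph

variable {V : Type*} (G : SimpleGraph V)

/-- `G` embeds in a closed connected surface of Euler genus `g`: some finite cell decomposition of
such a surface has `G` as a subgraph of its 1-skeleton.  The 1-skeleton may have further vertices
and edges, so the embedding of `G` itself need not be cellular, and `G` need not be connected. -/
def EmbedsInEulerGenus (g : ℕ) : Prop :=
  ∃ (D : Type) (_ : Finite D) (M : CellularSurface D),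
    M.eulerGenus = (g : ℤ) ∧ G.IsContained M.skeleton

/-- The Euler genus of a graph: the minimum Euler genus of a closed surface in which it embeds
(`⊤` if there is none). -/
noncomputable def eulerGenus : ℕ∞ := ⨅ (g : ℕ) (_ : G.EmbedsInEulerGenus g), (g : ℕ∞)

/-- A layering of `G`, where `L v` is the index of the layer of the vertex `v`. -/
def IsLayering (L : V → ℕ) : Prop :=
  ∀ v w, G.Adj v w → |(L v : ℤ) - (L w : ℤ)| ≤ 1

/-- `B` is the family of bags of an `H`-decomposition of `G`. -/
structure IsDecomposition {ι : Type*} (H : SimpleGraph ι) (B : ι → Set V) : Prop where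
  edge_mem : ∀ v w, G.Adj v w → ∃ x, v ∈ B x ∧ w ∈ B x
  connected : ∀ v, (H.induce {x | v ∈ B x}).Connected

/-- The layered width of a decomposition with bags `B`: the minimum over all layerings of the
maximum number of vertices in the intersection of a bag and a layer. -/
noncomputable def layeredWidth {ι : Type*} (B : ι → Set V) : ℕ∞ :=
  ⨅ (L : V → ℕ) (_ : G.IsLayering L), ⨆ (x : ι) (i : ℕ), (B x ∩ {v | L v = i}).encard

/-- The layered treewidth: the minimum layered width of a tree decomposition. -/
noncomputable def layeredTreewidth : ℕ∞ :=
  ⨅ (ι : Type) (_ : Finite ι) (T : SimpleGraph ι) (_ : T.IsTree) (B : ι → Set V)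
    (_ : G.IsDecomposition T B), G.layeredWidth B

end SimpleGraph

/-! ### Fixed-point-free involutions: parity and orbits. -/

section Involutions

variable {D : Type*}

/-! This is a tree-cotree argument. Take a breadth-first spanning tree of the 1-skeleton; its depths
form the layering, and each path to the root meets a layer at most once. Cut each face into a fan of
(possibly degenerate) triangles from a base corner, one triangle per side of an edge. The dual
multigraph on these triangles, not crossing tree edges, is connected, and Euler's formula
(`card_dualEdge`) shows that a spanning tree `T` of it misses at most `g` dual edges
(`exists_isTree_dual`). The bag of a triangle is the union of the root paths from its three vertices
and from both ends of each segment crossed by a missed dual edge: at most `2g + 3` paths.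

A vertex `v` on a path of the second kind is in all bags. Otherwise every dual edge crossing a
segment with an end in the subtree hanging from `v` belongs to `T`, and walking around that subtree
links all triangles touching it (`rel_of_below`, `induce_reachable`). Around a vertex or a face the
walk is a cycle of flags with one step forbidden (the parent edge or the base corner), and a cycle
minus one step is still connected (`rel_of_orbit_of_involutions`). -/

theorem Finset.even_card_of_involution (S : Finset D) (σ : D → D) (hσ : ∀ a, σ (σ a) = a)
    (hne : ∀ a, σ a ≠ a) (hS : ∀ a ∈ S, σ a ∈ S) : Even S.card := by
  have h : ∑ _a ∈ S, (1 : ZMod 2) = 0 :=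
    Finset.sum_involution (fun a _ => σ a) (fun _ _ => by decide) (fun a _ _ => hne a) hS
      (fun a _ => hσ a)
  rw [Finset.sum_const, nsmul_eq_mul, mul_one] at h
  exact (ZMod.natCast_eq_zero_iff_even).1 h

/-- Following two fixed-point-free involutions alternately from `a`, one reaches `τ a` without
using the step between `a` and `τ a`. -/
theorem mem_of_closed_under_involutions [Finite D] {σ τ : D → D}
    (hσ : ∀ a, σ (σ a) = a) (hτ : ∀ a, τ (τ a) = a) (hσ_ne : ∀ a, σ a ≠ a) (hτ_ne : ∀ a, τ a ≠ a)
    {S : Set D} {a : D} (ha : a ∈ S) (hSσ : ∀ x ∈ S, σ x ∈ S)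
    (hSτ : ∀ x ∈ S, x ≠ a → x ≠ τ a → τ x ∈ S) : τ a ∈ S := by
  classical
  -- If `τ a ∉ S`, then `σ` pairs up `S` while `τ` pairs up `S` without `a`, so both would have even
  -- size.
  by_contra hta
  have := Fintype.ofFinite D
  have h1 : Even S.toFinset.card :=
    Finset.even_card_of_involution _ σ hσ hσ_ne (by simpa using hSσ)
  have h2 : Even (S.toFinset.erase a).card := by
    refine Finset.even_card_of_involution _ τ hτ hτ_ne ?_
    intro x hx
    simp only [Finset.mem_erase, Set.mem_toFinset] at hx ⊢
    have hxt : x ≠ τ a := by rintro rfl; exact hta hx.2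
    refine ⟨?_, hSτ x hx.2 hx.1 hxt⟩
    rintro rfl
    exact hxt (hτ x).symm
  have h3 := Finset.card_erase_add_one (Set.mem_toFinset.2 ha)
  rw [← h3, Nat.even_add_one] at h1
  exact h1 h2

/-- An orbit of two fixed-point-free involutions stays connected when the step between
`a` and `τ a` is removed. -/
theorem rel_of_orbit_of_involutions [Finite D] {σ τ : D → D}
    (hσ : ∀ a, σ (σ a) = a) (hτ : ∀ a, τ (τ a) = a) (hσ_ne : ∀ a, σ a ≠ a) (hτ_ne : ∀ a, τ a ≠ a)
    (R : Setoid D) (a : D) {Q : Type*} (q : D → Q) (hqσ : ∀ x, q (σ x) = q x)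
    (hqτ : ∀ x, q (τ x) = q x)
    (hq : ∀ x y, q x = q y → Relation.EqvGen (fun x y => σ x = y ∨ τ x = y) x y)
    (hRσ : ∀ x, q x = q a → R x (σ x))
    (hRτ : ∀ x, q x = q a → x ≠ a → x ≠ τ a → R x (τ x))
    {x y : D} (hx : q x = q a) (hy : q y = q a) : R x y := by
  have key : R a (τ a) := by
    refine (mem_of_closed_under_involutions (S := {x | q x = q a ∧ R a x}) hσ hτ hσ_ne hτ_ne
      ⟨rfl, R.refl a⟩ ?_ ?_).2
    · rintro x ⟨hx, hax⟩
      exact ⟨(hqσ x).trans hx, R.trans hax (hRσ x hx)⟩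
    · rintro x ⟨hx, hax⟩ h1 h2
      exact ⟨(hqτ x).trans hx, R.trans hax (hRτ x hx h1 h2)⟩
  have hRτ' : ∀ x, q x = q a → R x (τ x) := by
    intro x hx
    by_cases h1 : x = a
    · exact h1 ▸ key
    by_cases h2 : x = τ a
    · rw [h2, hτ]
      exact R.symm key
    exact hRτ x hx h1 h2
  have hind : ∀ x y, Relation.EqvGen (fun x y => σ x = y ∨ τ x = y) x y →
      q x = q y ∧ (q x = q a → R x y) := by
    intro x y h
    induction h with
    | rel x y h =>
      rcases h with rfl | rfl
      · exact ⟨(hqσ x).symm, hRσ x⟩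
      · exact ⟨(hqτ x).symm, hRτ' x⟩
    | refl x => exact ⟨rfl, fun _ => R.refl x⟩
    | symm x y _ ih => exact ⟨ih.1.symm, fun h => R.symm (ih.2 (ih.1.trans h))⟩
    | trans x y z _ _ ih1 ih2 =>
      exact ⟨ih1.1.trans ih2.1, fun h => R.trans (ih1.2 h) (ih2.2 (ih1.1.symm.trans h))⟩
  exact (hind x y (hq x y (hx.trans hy.symm))).2 hx

theorem Quot.eq_or_eq_of_involution {σ : D → D} (hσ : ∀ a, σ (σ a) = a) {x y : D}
    (h : Quot.mk (fun a b => σ a = b) x = Quot.mk _ y) : y = x ∨ y = σ x := by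
  replace h := Quot.eqvGen_exact h
  induction h with
  | rel x y h => exact Or.inr h.symm
  | refl x => exact Or.inl rfl
  | symm x y _ ih => rcases ih with h | h <;> simp [h, hσ]
  | trans x y z _ _ ih1 ih2 =>
    rcases ih1 with rfl | rfl <;> rcases ih2 with rfl | rfl <;> simp [hσ]

theorem two_mul_card_quot_involution [Finite D] {σ : D → D} (hσ : ∀ a, σ (σ a) = a)
    (hσ_ne : ∀ a, σ a ≠ a) : 2 * Nat.card (Quot fun a b => σ a = b) = Nat.card D := by
  classical
  have := Fintype.ofFinite D
  have : Finite (Quot fun a b => σ a = b) := Quot.finite _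
  have := Fintype.ofFinite (Quot fun a b => σ a = b)
  rw [Nat.card_eq_fintype_card, Nat.card_eq_fintype_card, ← Finset.card_univ (α := D),
    Finset.card_eq_sum_card_fiberwise (f := Quot.mk fun a b => σ a = b)
      (t := Finset.univ) (by simp), Finset.sum_const_nat (m := 2), mul_comm, Finset.card_univ]
  intro c _
  induction c using Quot.ind with | mk a =>
  have : (Finset.univ.filter fun x => Quot.mk (fun a b => σ a = b) x = Quot.mk _ a)
      = {a, σ a} := by
    ext x
    simp only [Finset.mem_filter, Finset.mem_univ, true_and, Finset.mem_insert,
      Finset.mem_singleton]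
    constructor
    · intro h
      exact Quot.eq_or_eq_of_involution hσ h.symm
    · rintro (rfl | rfl)
      · rfl
      · exact (Quot.sound (r := fun a b => σ a = b) rfl).symm
  rw [this, Finset.card_pair (hσ_ne a).symm]

theorem Nat.card_forall_ne_add_card {A B : Type*} [Finite B] {f : A → B}
    (hf : Function.Injective f) : Nat.card {b // ∀ a, f a ≠ b} + Nat.card A = Nat.card B := by
  have h := Set.ncard_add_ncard_compl (Set.range f)
  rw [← Nat.card_coe_set_eq, Nat.card_range_of_injective hf, ← Nat.card_coe_set_eq, add_comm] at h
  rw [← h]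
  congr 1
  refine Nat.card_congr (Equiv.subtypeEquivRight ?_)
  intro b
  simp

end Involutions

/-! ### Sides, corners and incidences of flags. -/

namespace CellularSurface

variable {D : Type*} (M : CellularSurface D)

/-- The sides of edges: classes of flags under the move that keeps the edge and the face. -/
def Side : Type _ := Quot fun a b : D => M.flipVertex a = b

/-- The corners of faces: classes of flags under the move that keeps the vertex and the face. -/
def Corner : Type _ := Quot fun a b : D => M.flipEdge a = b

/-- The edge of a flag. -/
def edgeOf (a : D) : M.Edge := Quot.mk _ a

/-- The face of a flag. -/
def faceOf (a : D) : M.Face := Quot.mk _ a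

/-- The side of an edge determined by a flag. -/
def sideOf (a : D) : M.Side := Quot.mk _ a

/-- The corner determined by a flag. -/
def cornerOf (a : D) : M.Corner := Quot.mk _ a

instance [Finite D] : Finite M.Vertex := Quot.finite _
instance [Finite D] : Finite M.Edge := Quot.finite _
instance [Finite D] : Finite M.Face := Quot.finite _
instance [Finite D] : Finite M.Side := Quot.finite _
instance [Finite D] : Finite M.Corner := Quot.finite _

@[simp] theorem vertexOf_flipEdge (a : D) : M.vertexOf (M.flipEdge a) = M.vertexOf a :=
  Eq.symm (by exact Quot.sound (Or.inl rfl))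

@[simp] theorem vertexOf_flipFace (a : D) : M.vertexOf (M.flipFace a) = M.vertexOf a :=
  Eq.symm (by exact Quot.sound (Or.inr rfl))

@[simp] theorem faceOf_flipVertex (a : D) : M.faceOf (M.flipVertex a) = M.faceOf a :=
  Eq.symm (by exact Quot.sound (Or.inl rfl))

@[simp] theorem faceOf_flipEdge (a : D) : M.faceOf (M.flipEdge a) = M.faceOf a :=
  Eq.symm (by exact Quot.sound (Or.inr rfl))

@[simp] theorem sideOf_flipVertex (a : D) : M.sideOf (M.flipVertex a) = M.sideOf a :=
  (Quot.sound (r := fun a b : D => M.flipVertex a = b) rfl).symm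

theorem eq_or_eq_of_edgeOf_eq {a b : D} (h : M.edgeOf a = M.edgeOf b) :
    b = a ∨ b = M.flipVertex a ∨ b = M.flipFace a ∨ b = M.flipVertex (M.flipFace a) := by
  replace h := Quot.eqvGen_exact h
  induction h with
  | rel x y h => rcases h with h | h <;> simp [← h]
  | refl x => exact Or.inl rfl
  | symm x y _ ih =>
    rcases ih with h | h | h | h <;>
      simp [h, M.flipVertex_flipVertex, M.flipFace_flipFace, M.flipVertex_flipFace]
  | trans x y z _ _ ih1 ih2 =>
    rcases ih1 with h1 | h1 | h1 | h1 <;> rcases ih2 with h2 | h2 | h2 | h2 <;>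
      simp [h1, h2, M.flipVertex_flipVertex, M.flipFace_flipFace, M.flipVertex_flipFace]

/-- A flag at a chosen base corner of a face. -/
noncomputable def base (f : M.Face) : D := Quot.out f

@[simp] theorem faceOf_base (f : M.Face) : M.faceOf (M.base f) = f := Quot.out_eq f

theorem card_side_eq_card_corner [Finite D] : Nat.card M.Side = Nat.card M.Corner := by
  have h1 := two_mul_card_quot_involution M.flipVertex_flipVertex M.flipVertex_ne
  have h2 := two_mul_card_quot_involution M.flipEdge_flipEdge M.flipEdge_ne
  unfold Side Corner
  omega

/-! ### Breadth-first spanning tree of the 1-skeleton. -/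

theorem skeleton_connected : M.skeleton.Connected := by
  have key : ∀ a b, M.skeleton.Reachable (M.vertexOf a) (M.vertexOf b) := by
    intro a b
    induction M.connected a b with
    | rel x y h =>
      rcases h with rfl | rfl | rfl
      · by_cases h : M.vertexOf x = M.vertexOf (M.flipVertex x)
        · rw [← h]
        · exact SimpleGraph.Adj.reachable ⟨h, x, rfl, rfl⟩
      · simp
      · simp
    | refl x => exact .refl _
    | symm x y _ ih => exact ih.symm
    | trans x y z _ _ ih1 ih2 => exact ih1.trans ih2
  have : Nonempty M.Vertex := M.nonempty.map M.vertexOf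
  refine ⟨fun x y => ?_⟩
  induction x using Quot.ind
  induction y using Quot.ind
  exact key _ _

/-- A rooted spanning tree of the 1-skeleton, given by a flag `up w` from each vertex `w`
towards its parent (an arbitrary flag at `w` when `w` is the root). -/
structure VertexTree where
  root : M.Vertex
  depth : M.Vertex → ℕ
  up : M.Vertex → D
  vertexOf_up : ∀ w, M.vertexOf (up w) = w
  depth_up : ∀ w, w ≠ root → depth w = depth (M.vertexOf (M.flipVertex (up w))) + 1

/-- Depth is distance to the root; the first step of a shortest walk supplies `up`. -/
theorem exists_vertexTree_isLayering :
    ∃ t : M.VertexTree, M.skeleton.IsLayering t.depth := by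
  obtain ⟨a₀⟩ := M.nonempty
  set r := M.vertexOf a₀
  have hc := M.skeleton_connected
  have hup : ∀ w, ∃ a, M.vertexOf a = w ∧ (w ≠ r → M.skeleton.dist w r =
      M.skeleton.dist (M.vertexOf (M.flipVertex a)) r + 1) := by
    intro w
    obtain ⟨p, hp⟩ := hc.exists_walk_length_eq_dist w r
    cases p with
    | nil => exact ⟨a₀, rfl, fun h => absurd rfl h⟩
    | cons h q =>
      rename_i u
      obtain ⟨a, ha, hu⟩ := h.2
      refine ⟨a, ha, fun _ => ?_⟩
      have h1 := SimpleGraph.dist_le q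
      have h2 := hc.dist_triangle (u := w) (v := u) (w := r)
      have h3 := SimpleGraph.dist_eq_one_iff_adj.2 h
      rw [SimpleGraph.Walk.length_cons] at hp
      rw [hu]
      omega
  choose up h1 h2 using hup
  refine ⟨⟨r, fun w => M.skeleton.dist w r, up, h1, h2⟩, ?_⟩
  intro v w h
  have h1 := hc.dist_triangle (u := w) (v := v) (w := r)
  have h2 := hc.dist_triangle (u := v) (v := w) (w := r)
  have h3 := SimpleGraph.dist_eq_one_iff_adj.2 h
  have h4 := SimpleGraph.dist_eq_one_iff_adj.2 h.symm
  rw [abs_le]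
  constructor <;> simp only <;> omega

namespace VertexTree

variable {M} (t : M.VertexTree)

/-- The parent of a vertex. -/
def parent (w : M.Vertex) : M.Vertex := M.vertexOf (M.flipVertex (t.up w))

/-- `t.Below w v`: the vertex `v` lies on the path of the tree from `w` to the root. -/
def Below : M.Vertex → M.Vertex → Prop :=
  Relation.ReflTransGen fun x y => x ≠ t.root ∧ t.parent x = y

theorem depth_parent {w : M.Vertex} (h : w ≠ t.root) : t.depth w = t.depth (t.parent w) + 1 :=
  t.depth_up w h

theorem below_iff {w v : M.Vertex} :
    t.Below w v ↔ w = v ∨ ∃ u, t.Below w u ∧ u ≠ t.root ∧ t.parent u = v := by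
  unfold Below
  rw [Relation.ReflTransGen.cases_tail_iff]
  simp [eq_comm]

theorem Below.depth_le {w v : M.Vertex} (h : t.Below w v) : t.depth v ≤ t.depth w := by
  induction h with
  | refl => rfl
  | tail _ h ih =>
    obtain ⟨h, rfl⟩ := h
    have := t.depth_parent h
    omega

theorem Below.eq_of_depth_eq {w v : M.Vertex} (h : t.Below w v) (hd : t.depth w = t.depth v) :
    w = v := by
  rcases t.below_iff.1 h with h | ⟨u, hwu, hu, rfl⟩
  · exact h
  · have h1 := Below.depth_le t hwu
    have h2 := t.depth_parent hu
    omega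

/-- The ancestors of `w` form a chain on which depth is strictly monotone. -/
theorem eq_of_below_of_depth_eq {w v v' : M.Vertex} (h : t.Below w v) (h' : t.Below w v')
    (hd : t.depth v = t.depth v') : v = v' := by
  rcases Relation.ReflTransGen.total_of_right_unique
    (fun x y z hy hz => hy.2.symm.trans hz.2) h h' with h | h
  · exact Below.eq_of_depth_eq t h hd
  · exact (Below.eq_of_depth_eq t h hd.symm).symm

theorem below_root (w : M.Vertex) : t.Below w t.root := by
  induction h : t.depth w generalizing w with
  | zero =>
    by_cases hw : w = t.root
    · exact hw ▸ .refl
    · have := t.depth_parent hw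
      omega
  | succ n ih =>
    by_cases hw : w = t.root
    · exact hw ▸ .refl
    · have := t.depth_parent hw
      exact .head ⟨hw, rfl⟩ (ih _ (by omega))

/-- Each `w ∈ W` has at most one ancestor at depth `i`, so choosing a descendant in `W` is
injective. -/
theorem encard_below_inter_layer_le (W : Finset M.Vertex) (i : ℕ) :
    ({v | ∃ w ∈ W, t.Below w v} ∩ {v | t.depth v = i}).encard ≤ W.card := by
  rw [← Set.encard_coe_eq_coe_finsetCard]
  have : Nonempty M.Vertex := ⟨t.root⟩
  choose! f hf using fun (v : M.Vertex) (h : ∃ w ∈ W, t.Below w v) => h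
  refine Set.encard_le_encard_of_injOn (f := f) (fun v hv => (hf v hv.1).1) ?_
  intro v hv v' hv' h
  exact t.eq_of_below_of_depth_eq (hf v hv.1).2 (h ▸ (hf v' hv'.1).2) (hv.2.trans hv'.2.symm)

/-- The edge `e` belongs to the tree. -/
def IsTreeEdge (e : M.Edge) : Prop := ∃ w, w ≠ t.root ∧ M.edgeOf (t.up w) = e

/-- Distinct vertices sharing their upward edge would be each other's parents, which the depths
forbid. -/
theorem injective_edgeOf_up :
    Function.Injective fun w : {w // w ≠ t.root} => M.edgeOf (t.up w) := by
  rintro ⟨u, hu⟩ ⟨w, hw⟩ h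
  have h1 : ∀ w, M.vertexOf (M.flipVertex (t.up w)) = t.parent w := fun _ => rfl
  have hpu := t.depth_parent hu
  have hpw := t.depth_parent hw
  have hv := t.vertexOf_up w
  rw [Subtype.mk.injEq]
  rcases M.eq_or_eq_of_edgeOf_eq h with h | h | h | h <;> simp only at h <;>
    rw [h] at hv <;>
    simp only [M.flipVertex_flipFace, vertexOf_flipFace, h1, t.vertexOf_up] at hv
  · exact hv
  · have : t.parent w = u := by
      rw [parent, h, M.flipVertex_flipVertex, t.vertexOf_up]
    rw [hv] at hpu
    rw [this] at hpw
    omega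
  · exact hv
  · have : t.parent w = u := by
      rw [parent, h, M.flipVertex_flipVertex, vertexOf_flipFace, t.vertexOf_up]
    rw [hv] at hpu
    rw [this] at hpw
    omega

/-- The flags at the vertices below `v` are connected around the part of the tree below `v`,
without crossing the edges of the tree. -/
theorem rel_of_below [Finite D] (R : Setoid D) (v : M.Vertex)
    (hV : ∀ a, R a (M.flipVertex a))
    (hE : ∀ a, t.Below (M.vertexOf a) v → R a (M.flipEdge a))
    (hF : ∀ a, t.Below (M.vertexOf a) v → ¬ t.IsTreeEdge (M.edgeOf a) → R a (M.flipFace a))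
    {a b : D} (ha : t.Below (M.vertexOf a) v) (hb : t.Below (M.vertexOf b) v) : R a b := by
  -- Induct from the deepest vertices upwards; beyond the maximal depth the claim is vacuous.
  obtain ⟨K, hK⟩ := (Set.finite_range t.depth).bddAbove
  replace hK : ∀ w, t.depth w ≤ K := fun w => hK ⟨w, rfl⟩
  suffices key : ∀ n w, K + 1 ≤ t.depth w + n → t.Below w v → ∀ a, t.Below (M.vertexOf a) w →
      R (t.up w) a from
    R.trans (R.symm (key (K + 1) v (by omega) .refl a ha)) (key (K + 1) v (by omega) .refl b hb)
  clear ha hb a b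
  intro n
  induction n with
  | zero =>
    intro w hw
    have := hK w
    omega
  | succ n ih =>
    intro w hw hwv a ha
    have hchild : ∀ u, u ≠ t.root → t.parent u = w → ∀ a, t.Below (M.vertexOf a) u →
        R (t.up u) a := by
      rintro u hu rfl
      have := t.depth_parent hu
      exact ih u (by omega) (.head ⟨hu, rfl⟩ hwv)
    have hup := t.vertexOf_up
    have hw' : ∀ a, M.vertexOf a = w → R (t.up w) a := by
      intro a ha
      -- Rotate about `w`; the omitted step crosses the parent edge (an arbitrary edge at the root).
      refine rel_of_orbit_of_involutions M.flipEdge_flipEdge M.flipFace_flipFace M.flipEdge_ne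
        M.flipFace_ne R (t.up w) M.vertexOf M.vertexOf_flipEdge M.vertexOf_flipFace
        (fun x y h => Quot.eqvGen_exact h) ?_ ?_ rfl (ha.trans (hup w).symm)
      · intro x hx
        rw [hup] at hx
        exact hE x (hx ▸ hwv)
      · intro x hx h1 h2
        rw [hup] at hx
        by_cases hx' : t.IsTreeEdge (M.edgeOf x)
        -- Any other tree edge here leads to a child `u`: walk along it, around the subtree of `u`,
        -- and back on its other side.
        · obtain ⟨u, hu, hux⟩ := hx'
          have hflip : t.parent u = w → R (t.up u) (M.flipFace (t.up u)) := fun h =>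
            hchild u hu h _ (by rw [vertexOf_flipFace, hup]; exact .refl)
          rcases M.eq_or_eq_of_edgeOf_eq hux with rfl | rfl | rfl | rfl
          · exact absurd (by rw [← hx, hup]) h1
          · rw [← M.flipVertex_flipFace]
            exact R.trans (R.symm (hV _)) (R.trans (hflip hx) (hV _))
          · exact absurd (by rw [← hx, vertexOf_flipFace, hup]) h2
          · rw [M.flipVertex_flipFace, vertexOf_flipFace] at hx
            nth_rw 2 [M.flipVertex_flipFace]
            rw [M.flipFace_flipFace]
            exact R.trans (R.symm (hV _)) (R.trans (R.symm (hflip hx)) (hV _))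
        · exact hF x (hx ▸ hwv) hx'
    rcases t.below_iff.1 ha with ha | ⟨u, hau, hu, huw⟩
    · exact hw' a ha
    · exact R.trans (hw' _ huw) (R.trans (R.symm (hV _)) (hchild u hu huw a hau))

end VertexTree

end CellularSurface

/-! ### The dual multigraph and its spanning tree. -/

namespace SimpleGraph

theorem induce_reachable_of_reachable {N : Type*} {K K' : SimpleGraph N} {S : Set N}
    (h : ∀ s t, K'.Adj s t → K.Adj s t ∧ s ∈ S ∧ t ∈ S) {s t : N} (hs : s ∈ S) (ht : t ∈ S)
    (hst : K'.Reachable s t) : (K.induce S).Reachable ⟨s, hs⟩ ⟨t, ht⟩ := by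
  obtain ⟨p⟩ := hst
  induction p with
  | nil => exact .refl _
  | cons hadj _ ih =>
    obtain ⟨h1, _, h2⟩ := h _ _ hadj
    exact (Adj.reachable (show (K.induce S).Adj ⟨_, hs⟩ ⟨_, h2⟩ from h1)).trans (ih h2 ht)

end SimpleGraph

namespace CellularSurface

variable {D : Type*} {M : CellularSurface D}

/-- The two sides meeting at a corner. -/
def Corner.sides : M.Corner → Sym2 M.Side :=
  Quot.lift (fun a => s(M.sideOf a, M.sideOf (M.flipEdge a))) (by
    rintro a _ rfl
    rw [M.flipEdge_flipEdge, Sym2.eq_swap])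

/-- The vertex of a corner and the base vertex of its face. -/
noncomputable def Corner.ends : M.Corner → Sym2 M.Vertex :=
  Quot.lift (fun a => s(M.vertexOf a, M.vertexOf (M.base (M.faceOf a)))) (by
    rintro a _ rfl
    simp)

/-- The two sides of an edge. -/
def Edge.sides : M.Edge → Sym2 M.Side :=
  Quot.lift (fun a => s(M.sideOf a, M.sideOf (M.flipFace a))) (by
    rintro a _ (rfl | rfl)
    · rw [← M.flipVertex_flipFace, sideOf_flipVertex, sideOf_flipVertex]
    · rw [M.flipFace_flipFace, Sym2.eq_swap])

/-- The two ends of an edge. -/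
def Edge.ends : M.Edge → Sym2 M.Vertex :=
  Quot.lift (fun a => s(M.vertexOf a, M.vertexOf (M.flipVertex a))) (by
    rintro a _ (rfl | rfl)
    · rw [M.flipVertex_flipVertex, Sym2.eq_swap]
    · rw [M.flipVertex_flipFace, vertexOf_flipFace, vertexOf_flipFace])

/-- The vertices in the triangle spanned by a side and the base vertex of its face. -/
noncomputable def Side.ends [DecidableEq M.Vertex] : M.Side → Finset M.Vertex :=
  Quot.lift (fun a => {M.vertexOf a, M.vertexOf (M.flipVertex a),
    M.vertexOf (M.base (M.faceOf a))}) (by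
    rintro a _ rfl
    rw [M.flipVertex_flipVertex, faceOf_flipVertex, Finset.insert_comm])

theorem Side.card_ends_le [DecidableEq M.Vertex] (s : M.Side) : s.ends.card ≤ 3 := by
  induction s using Quot.ind
  exact Finset.card_le_three

theorem Side.mem_ends_sideOf [DecidableEq M.Vertex] {a : D} {w : M.Vertex} :
    w ∈ (M.sideOf a).ends ↔ w = M.vertexOf a ∨ w = M.vertexOf (M.flipVertex a) ∨
      w = M.vertexOf (M.base (M.faceOf a)) := by
  change w ∈ ({M.vertexOf a, M.vertexOf (M.flipVertex a),
    M.vertexOf (M.base (M.faceOf a))} : Finset _) ↔ _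
  simp

namespace VertexTree

variable (t : M.VertexTree)

/-- The edges of the dual multigraph on the sides: it is the dual graph of the surface, triangulated
from the base vertices of the faces, without the edges dual to those of the tree. -/
def DualEdge : Type _ :=
  {c : M.Corner // ∀ f, M.cornerOf (M.base f) ≠ c} ⊕
    {e : M.Edge // ∀ w : {w // w ≠ t.root}, M.edgeOf (t.up w) ≠ e}

instance [Finite D] : Finite t.DualEdge := inferInstanceAs (Finite (_ ⊕ _))

/-- The two sides joined by a dual edge. -/
def DualEdge.sides : t.DualEdge → Sym2 M.Side :=
  Sum.elim (fun c => Corner.sides c.1) (fun e => Edge.sides e.1)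

/-- The two vertices joined by the segment that a dual edge crosses. -/
noncomputable def DualEdge.ends : t.DualEdge → Sym2 M.Vertex :=
  Sum.elim (fun c => Corner.ends c.1) (fun e => Edge.ends e.1)

/-- There are as many corners as sides; one corner per face and `|V| - 1` tree edges are discarded.
-/
theorem card_dualEdge [Finite D] :
    (Nat.card t.DualEdge : ℤ) + 1 = Nat.card M.Side + M.eulerGenus := by
  have h1 : Nat.card t.DualEdge = _ := Nat.card_sum
  have h2 := Nat.card_forall_ne_add_card (f := fun f => M.cornerOf (M.base f)) (by
    intro f f' h
    have hface : ∀ a b : D, M.cornerOf a = M.cornerOf b → M.faceOf a = M.faceOf b :=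
      fun a b h => congrArg (Quot.lift M.faceOf (by rintro a _ rfl; simp)) h
    simpa using hface _ _ h)
  have h3 := Nat.card_forall_ne_add_card t.injective_edgeOf_up
  have h4 : Nat.card {w // w ≠ t.root} + 1 = Nat.card M.Vertex := by
    rw [← Finite.card_option]
    classical exact Nat.card_congr (Equiv.optionSubtypeNe t.root)
  rw [← M.card_side_eq_card_corner] at h2
  unfold eulerGenus eulerChar
  omega

theorem exists_dualEdge_of_corner {a : D} (h : M.cornerOf a ≠ M.cornerOf (M.base (M.faceOf a))) :
    ∃ x : t.DualEdge, x.sides = s(M.sideOf a, M.sideOf (M.flipEdge a)) ∧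
      x.ends = s(M.vertexOf a, M.vertexOf (M.base (M.faceOf a))) := by
  refine ⟨.inl ⟨M.cornerOf a, fun f hf => h ?_⟩, rfl, rfl⟩
  have hface := congrArg (Quot.lift M.faceOf (by rintro a _ rfl; simp)) hf
  replace hface : M.faceOf (M.base f) = M.faceOf a := hface
  rw [← hf, ← hface, faceOf_base]

theorem exists_dualEdge_of_edge {a : D} (h : ¬ t.IsTreeEdge (M.edgeOf a)) :
    ∃ x : t.DualEdge, x.sides = s(M.sideOf a, M.sideOf (M.flipFace a)) ∧
      x.ends = s(M.vertexOf a, M.vertexOf (M.flipVertex a)) :=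
  ⟨.inr ⟨M.edgeOf a, fun w hw => h ⟨w, w.2, hw⟩⟩, rfl, rfl⟩

open Classical in
/-- If `K` contains the dual edges that cross segments with an end below `v`, then the sides
whose triangles have a vertex below `v` are connected in `K`. -/
theorem induce_reachable [Finite D] (K : SimpleGraph M.Side) (v : M.Vertex)
    (hK : ∀ x : t.DualEdge, (∃ w ∈ x.ends, t.Below w v) → ∀ s s', x.sides = s(s, s') →
      s = s' ∨ K.Adj s s')
    {s s' : M.Side} (hs : s ∈ {s : M.Side | ∃ w ∈ s.ends, t.Below w v})
    (hs' : s' ∈ {s : M.Side | ∃ w ∈ s.ends, t.Below w v}) :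
    (K.induce {s | ∃ w ∈ s.ends, t.Below w v}).Reachable ⟨s, hs⟩ ⟨s', hs'⟩ := by
  let S : Set M.Side := {s | ∃ w ∈ s.ends, t.Below w v}
  let K' : SimpleGraph M.Side :=
    { Adj := fun s s' => K.Adj s s' ∧ s ∈ S ∧ s' ∈ S
      symm := ⟨fun _ _ h => ⟨h.1.symm, h.2.2, h.2.1⟩⟩
      loopless := ⟨fun _ h => h.1.ne rfl⟩ }
  let R : Setoid D := K'.reachableSetoid.comap M.sideOf
  have hadj : ∀ (x : t.DualEdge) (a b : D), (∃ w ∈ x.ends, t.Below w v) →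
      x.sides = s(M.sideOf a, M.sideOf b) → M.sideOf a ∈ S → M.sideOf b ∈ S → R a b := by
    intro x a b hx hab ha hb
    rcases hK x hx _ _ hab with h | h
    · exact (show K'.Reachable (M.sideOf a) (M.sideOf b) from h ▸ .refl _)
    · exact (show K'.Adj (M.sideOf a) (M.sideOf b) from ⟨h, ha, hb⟩).reachable
  have hV : ∀ a, R a (M.flipVertex a) := fun a =>
    (show K'.Reachable (M.sideOf a) (M.sideOf (M.flipVertex a)) by rw [sideOf_flipVertex])
  have hS : ∀ a, t.Below (M.vertexOf a) v → M.sideOf a ∈ S := fun a ha =>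
    ⟨_, Side.mem_ends_sideOf.2 (Or.inl rfl), ha⟩
  have hface : ∀ f, t.Below (M.vertexOf (M.base f)) v → ∀ a, M.faceOf a = f →
      R a (M.base f) := by
    intro f hf a ha
    have hSf : ∀ x, M.faceOf x = f → M.sideOf x ∈ S := fun x hx =>
      ⟨_, Side.mem_ends_sideOf.2 (Or.inr (Or.inr rfl)), hx ▸ hf⟩
    -- Go round the face, omitting the base corner; every other corner crosses a segment ending at
    -- the base vertex, which is below `v`.
    refine rel_of_orbit_of_involutions M.flipVertex_flipVertex M.flipEdge_flipEdge M.flipVertex_ne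
        M.flipEdge_ne R (M.base f) M.faceOf M.faceOf_flipVertex M.faceOf_flipEdge
        (fun x y h => Quot.eqvGen_exact h) (fun x _ => hV x) ?_ (by rw [ha, faceOf_base]) rfl
    intro x hx h1 h2
    rw [faceOf_base] at hx
    obtain ⟨y, hy1, hy2⟩ := t.exists_dualEdge_of_corner (a := x) (by
      intro h
      rw [hx] at h
      exact (Quot.eq_or_eq_of_involution M.flipEdge_flipEdge h.symm).elim h1 h2)
    refine hadj y _ _ ⟨_, ?_, hf⟩ hy1 (hSf x hx) (hSf _ (by rw [faceOf_flipEdge, hx]))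
    rw [hy2, hx]
    exact Sym2.mem_mk_right _ _
  have hrel : ∀ {a b : D}, t.Below (M.vertexOf a) v → t.Below (M.vertexOf b) v → R a b := by
    intro a b ha hb
    refine t.rel_of_below R v hV ?_ ?_ ha hb
    · intro a ha
      have hSE := hS (M.flipEdge a) (by rwa [vertexOf_flipEdge])
      -- No dual edge crosses the base corner, so there the walk takes the long way round the face.
      by_cases hc : M.cornerOf a = M.cornerOf (M.base (M.faceOf a))
      · have hv : M.vertexOf a = M.vertexOf (M.base (M.faceOf a)) :=
          congrArg (Quot.lift M.vertexOf (by rintro a _ rfl; simp)) hc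
        have h := hface (M.faceOf a) (hv ▸ ha)
        exact R.trans (h a rfl) (R.symm (h _ (M.faceOf_flipEdge a)))
      · obtain ⟨y, hy1, hy2⟩ := t.exists_dualEdge_of_corner hc
        exact hadj y _ _ ⟨_, hy2 ▸ Sym2.mem_mk_left _ _, ha⟩ hy1 (hS a ha) hSE
    · intro a ha hT
      have hSF := hS (M.flipFace a) (by rwa [vertexOf_flipFace])
      obtain ⟨y, hy1, hy2⟩ := t.exists_dualEdge_of_edge hT
      exact hadj y _ _ ⟨_, hy2 ▸ Sym2.mem_mk_left _ _, ha⟩ hy1 (hS a ha) hSF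
  have hflag : ∀ s ∈ S, ∃ a, t.Below (M.vertexOf a) v ∧ K'.Reachable s (M.sideOf a) := by
    intro s hs
    induction s using Quot.ind with | mk a =>
    obtain ⟨w, hw, hwv⟩ := hs
    rcases Side.mem_ends_sideOf.1 hw with rfl | rfl | rfl
    · exact ⟨a, hwv, .refl _⟩
    · exact ⟨_, hwv, hV a⟩
    · exact ⟨_, hwv, hface _ hwv a rfl⟩
  refine SimpleGraph.induce_reachable_of_reachable (K' := K') (fun _ _ h => h) hs hs' ?_
  obtain ⟨a, ha, hsa⟩ := hflag s hs
  obtain ⟨b, hb, hsb⟩ := hflag s' hs'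
  exact hsa.trans ((show K'.Reachable _ _ from hrel ha hb).trans hsb.symm)

/-- There is a tree on the sides such that all but `M.eulerGenus` dual edges belong to it. -/
theorem exists_isTree_dual [Finite D] :
    ∃ (T : SimpleGraph M.Side) (X : Finset t.DualEdge), T.IsTree ∧
      (X.card : ℤ) ≤ M.eulerGenus ∧ ∀ x ∉ X, x.sides ∈ T.edgeSet := by
  classical
  let H : SimpleGraph M.Side := .fromEdgeSet (Set.range (DualEdge.sides t))
  have hne : Nonempty M.Side := M.nonempty.map M.sideOf
  have hH : H.Connected := by
    refine ⟨fun s s' => ?_⟩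
    -- With `v` the root, every side qualifies, so the local statement yields connectivity of all of
    -- `H`.
    have hS : ∀ s : M.Side, ∃ w ∈ s.ends, t.Below w t.root := by
      intro s
      induction s using Quot.ind with | mk a =>
      exact ⟨_, Side.mem_ends_sideOf.2 (Or.inl rfl), t.below_root _⟩
    refine (t.induce_reachable H t.root ?_ (hS s) (hS s')).map
      (SimpleGraph.Embedding.induce _).toHom
    intro x _ s s' hx
    by_cases h : s = s'
    · exact Or.inl h
    · exact Or.inr ((SimpleGraph.fromEdgeSet_adj _).2 ⟨⟨x, hx⟩, h⟩)
  obtain ⟨T, hTH, hT⟩ := hH.exists_isTree_le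
  have := Fintype.ofFinite t.DualEdge
  -- Dual edges parallel to an edge of `T` are not exceptional, which only makes `X` smaller.
  refine ⟨T, Finset.univ.filter fun x => x.sides ∉ T.edgeSet, hT, ?_, by simp⟩
  have h1 := (SimpleGraph.isTree_iff_connected_and_card.1 hT).2
  have h2 := t.card_dualEdge
  have h3 := Finset.card_filter_add_card_filter_not (s := Finset.univ)
    (fun x : t.DualEdge => x.sides ∈ T.edgeSet)
  have h4 : Nat.card T.edgeSet ≤
      (Finset.univ.filter fun x : t.DualEdge => x.sides ∈ T.edgeSet).card := by
    rw [← Fintype.card_subtype, ← Nat.card_eq_fintype_card]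
    refine Nat.card_le_card_of_surjective (fun x => ⟨x.1.sides, x.2⟩) ?_
    rintro ⟨e, he⟩
    have he' := SimpleGraph.edgeSet_mono hTH he
    rw [SimpleGraph.edgeSet_fromEdgeSet] at he'
    obtain ⟨x, rfl⟩ := he'.1
    exact ⟨⟨x, he⟩, rfl⟩
  rw [Finset.card_univ, ← Nat.card_eq_fintype_card] at h3
  omega

end VertexTree

/-! ### The tree decomposition and the width bound. -/

theorem exists_isDecomposition_skeleton [Finite D] (M : CellularSurface D) {g : ℕ}
    (hg : M.eulerGenus ≤ g) :
    ∃ (T : SimpleGraph M.Side) (B : M.Side → Set M.Vertex) (L : M.Vertex → ℕ), T.IsTree ∧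
      M.skeleton.IsDecomposition T B ∧ M.skeleton.IsLayering L ∧
      ∀ s i, (B s ∩ {v | L v = i}).encard ≤ 2 * (g : ℕ∞) + 3 := by
  classical
  obtain ⟨t, ht⟩ := M.exists_vertexTree_isLayering
  obtain ⟨T, X, hT, hXg, hX⟩ := t.exists_isTree_dual
  -- Two ends for each of at most `g` exceptional dual edges, plus three triangle vertices.
  let W : M.Side → Finset M.Vertex := fun s => X.biUnion (fun x => x.ends.toFinset) ∪ s.ends
  have hW : ∀ s, (W s).card ≤ 2 * g + 3 := by
    intro s
    have h1 : (X.biUnion fun x => x.ends.toFinset).card ≤ X.card * 2 :=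
      Finset.card_biUnion_le_card_mul _ _ _ (fun x _ => by
        rw [Sym2.card_toFinset]
        split_ifs <;> omega)
    have h2 := Finset.card_union_le (X.biUnion fun x => x.ends.toFinset) s.ends
    have h3 := s.card_ends_le
    simp only [W]
    omega
  refine ⟨T, fun s => {v | ∃ w ∈ W s, t.Below w v}, t.depth, hT, ⟨?_, ?_⟩, ht, ?_⟩
  · rintro _ _ ⟨-, a, rfl, rfl⟩
    refine ⟨M.sideOf a, ⟨_, Finset.mem_union_right _ (Side.mem_ends_sideOf.2 (Or.inl rfl)), .refl⟩,
      ⟨_, Finset.mem_union_right _ (Side.mem_ends_sideOf.2 (Or.inr (Or.inl rfl))), .refl⟩⟩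
  · intro v
    by_cases hv : ∃ x ∈ X, ∃ w ∈ x.ends, t.Below w v
    · obtain ⟨x, hx, w, hw, hwv⟩ := hv
      have : {s | v ∈ {v | ∃ w ∈ W s, t.Below w v}} = Set.univ := by
        refine Set.eq_univ_of_forall fun s => ⟨w, Finset.mem_union_left _ ?_, hwv⟩
        exact Finset.mem_biUnion.2 ⟨x, hx, Sym2.mem_toFinset.2 hw⟩
      rw [this]
      exact (SimpleGraph.induceUnivIso T).connected_iff.2 hT.connected
    · have : {s | v ∈ {v | ∃ w ∈ W s, t.Below w v}} = {s | ∃ w ∈ s.ends, t.Below w v} := by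
        ext s
        simp only [Set.mem_ofPred_eq]
        refine ⟨?_, fun ⟨w, hw, h⟩ => ⟨w, Finset.mem_union_right _ hw, h⟩⟩
        rintro ⟨w, hw, hwv⟩
        rcases Finset.mem_union.1 hw with hw | hw
        · obtain ⟨x, hx, hw⟩ := Finset.mem_biUnion.1 hw
          exact absurd ⟨x, hx, w, Sym2.mem_toFinset.1 hw, hwv⟩ hv
        · exact ⟨w, hw, hwv⟩
      rw [this]
      have hne : Nonempty {s : M.Side | ∃ w ∈ s.ends, t.Below w v} :=
        ⟨M.sideOf (t.up v), _, Side.mem_ends_sideOf.2 (Or.inl (t.vertexOf_up v).symm), .refl⟩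
      refine ⟨fun s s' => t.induce_reachable T v ?_ s.2 s'.2⟩
      intro x hx s s' hs
      refine Or.inr ?_
      rw [← SimpleGraph.mem_edgeSet, ← hs]
      exact hX x fun h => hv ⟨x, h, hx⟩
  · intro s i
    exact (t.encard_below_inter_layer_le (W s) i).trans (by exact_mod_cast hW s)

end CellularSurface

theorem mainTheorem1 {V : Type*} [Finite V] (G : SimpleGraph V) (g : ℕ)
    (hg : G.eulerGenus = (g : ℕ∞)) :
    G.layeredTreewidth ≤ 2 * (g : ℕ∞) + 3 := by
  -- The strict bound extracts an actual embedding from the infimum.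
  have hlt : G.eulerGenus < ((g + 1 : ℕ) : ℕ∞) := by
    rw [hg]
    exact_mod_cast Nat.lt_succ_self g
  simp only [SimpleGraph.eulerGenus, iInf_lt_iff] at hlt
  obtain ⟨g', ⟨D, hD, M, hM, ⟨f⟩⟩, hg'⟩ := hlt
  have hle : g' ≤ g := Nat.lt_succ_iff.1 (by exact_mod_cast hg')
  obtain ⟨T, B, L, hT, hB, hL, hw⟩ :=
    M.exists_isDecomposition_skeleton (g := g) (by rw [hM]; exact_mod_cast hle)
  have hB' : G.IsDecomposition T fun s => f ⁻¹' B s :=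
    ⟨fun v w h => hB.edge_mem _ _ (f.toHom.map_adj h), fun v => hB.connected (f v)⟩
  have hL' : G.IsLayering fun v => L (f v) := fun v w h => hL _ _ (f.toHom.map_adj h)
  refine (iInf₂_le_of_le M.Side (inferInstanceAs (Finite M.Side)) <| iInf₂_le_of_le T hT <|
    iInf₂_le_of_le _ hB' le_rfl).trans ?_
  refine (iInf₂_le_of_le _ hL' le_rfl).trans (iSup₂_le fun s i => ?_)
  refine le_trans ?_ (hw s i)
  exact Set.encard_le_encard_of_injOn (f := f) (fun v hv => hv) f.injective.injOn
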